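/- Let $\mathcal{C}$ be a pointed model category with functorial factorizations. For objects $W,F$ let $[W,F]$ be the set of morphisms from $W$ to $F$ in the homotopy category (the localization of $\mathcal{C}$ at the weak equivalences), and call the class of the zero map in $[W,F]$ trivial. For maps $i,p$ in $\mathcal{C}$, a map $i\to p$ is a commutative square from $i$ to $p$. A cofibration $j:S\to T$ has an **obstruction theory** if there are an object $W$ and, for every fibration $p:X\to Y$ with fibre $F$ and every square $f:j\to p$, a class $\alpha_f\in[W,F]$ such that (1) the square $f$ has a lift $T\to X$ if and only if $\alpha_f$ is trivial; (2) for every map $\varphi:p\to p'$ between fibrations, with fibres $F$ and $F'$, the class $\alpha_{\varphi f}$ is the composite of $\alpha_f$ with the induced map $F\to F'$. It has a **fibrant obstruction theory** if the same holds when $p,p'$ range only over the fibrations with fibrant target. A suspension $\Sigma A$ of an object $A$ is a cofibre of a cofibration $A\to CA$ with $CA$ weakly contractible. If $i:A\to B$ is a map and $CA\to CB$ is a map extending $i$ between the chosen cones, the induced map $\Sigma A\to\Sigma B$ is called a construction of $\Sigma i$; its source is always cofibrant. Two maps are weakly equivalent if they are connected by a zigzag of levelwise weak equivalences in the category of arrows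 of $\mathcal{C}$. A **model for $\Sigma i$** is a map weakly equivalent to a construction of $\Sigma i$ which, unless $\mathcal{C}$ is left proper, is required to have cofibrant source, as all constructions themselves do. **Theorem.** Let $i:A\to B$ be a cofibration in $\mathcal{C}$, and suppose that $A$ is cofibrant or that $\mathcal{C}$ is left proper. Let $j$ be any model for $\Sigma i$ which is a cofibration. Then $j$ has a fibrant obstruction theory. If $\mathcal{C}$ is moreover right proper, then $j$ has an obstruction theory. -/

import Mathlib

open CategoryTheory Limits HomotopicalAlgebra

universe v u

namespace ObstructionTheory

section

variable (C : Type u) [Category.{v} C] [ModelCategory C]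

/-- A model category is left proper if every cobase change of a weak equivalence along a
cofibration is a weak equivalence. -/
def LeftProper : Prop :=
  ∀ ⦃A B A' B' : C⦄ (i : A ⟶ B) (w : A ⟶ A') (w' : B ⟶ B') (i' : A' ⟶ B'),
    IsPushout i w w' i' → Cofibration i → WeakEquivalence w → WeakEquivalence w'

/-- A model category is right proper if every base change of a weak equivalence along a
fibration is a weak equivalence. -/
def RightProper : Prop :=
  ∀ ⦃X Y X' Y' : C⦄ (p : X ⟶ Y) (w : Y' ⟶ Y) (w' : X' ⟶ X) (p' : X' ⟶ Y'),
    IsPullback w' p' p w → Fibration p → WeakEquivalence w → WeakEquivalence w'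

/-- Both factorizations of the model structure can be chosen functorially. -/
def HasFunctorialFactorizations : Prop :=
  MorphismProperty.HasFunctorialFactorization (cofibrations C) (trivialFibrations C) ∧
    MorphismProperty.HasFunctorialFactorization (trivialCofibrations C) (fibrations C)

/-- Fibrations with fibrant target. -/
def fibrationsWithFibrantTarget : MorphismProperty C :=
  fun _ Y p => Fibration p ∧ IsFibrant Y

/-- The localization functor from a model category to its homotopy category. The set `[W, F]` of
weak homotopy classes is the set of morphisms from `W` to `F` in the homotopy category. -/
abbrev toHo : C ⥤ (weakEquivalences C).Localization := (weakEquivalences C).Q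

end

variable {C : Type u} [Category.{v} C] [ModelCategory C]

/-- An object is weakly contractible if its map to the terminal object is a weak equivalence. -/
def IsWeaklyContractible (X : C) : Prop := WeakEquivalence (terminal.from X)

/-- Two maps are weakly equivalent if they are connected in the category of arrows by a zigzag of
levelwise weak equivalences. -/
def WeaklyEquivalent : Arrow C → Arrow C → Prop :=
  Relation.EqvGen fun f g => ∃ φ : f ⟶ g, WeakEquivalence φ.left ∧ WeakEquivalence φ.right

variable [HasZeroMorphisms C]

/-- An obstruction theory for `i : A ⟶ B` with respect to a class `P` of morphisms: an object `W`,
and for every `p : X ⟶ Y` in `P` with fibre `F` and every commutative square `i ⟶ p`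
a class in `[W, F]` which is trivial if and only if the square has a lift, and which is functorial
with respect to maps `p ⟶ p'` between members of `P`. -/
structure ObstructionTheoryFor {A B : C} (i : A ⟶ B) (P : MorphismProperty C) where
  W : C
  obstruction : ∀ ⦃p : Arrow C⦄, P p.hom → (Arrow.mk i ⟶ p) →
    ((toHo C).obj W ⟶ (toHo C).obj (kernel p.hom))
  lift_iff : ∀ ⦃p : Arrow C⦄ (hp : P p.hom) (f : Arrow.mk i ⟶ p),
    (∃ l : B ⟶ p.left, i ≫ l = f.left ∧ l ≫ p.hom = f.right) ↔
      obstruction hp f = (toHo C).map 0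
  functorial : ∀ ⦃p p' : Arrow C⦄ (hp : P p.hom) (hp' : P p'.hom)
    (f : Arrow.mk i ⟶ p) (φ : p ⟶ p'),
    obstruction hp' (f ≫ φ) =
      obstruction hp f ≫ (toHo C).map (kernel.map p.hom p'.hom φ.left φ.right φ.w.symm)

/-- `i` has an obstruction theory (with respect to all fibrations). -/
def HasObstructionTheory {A B : C} (i : A ⟶ B) : Prop :=
  Nonempty (ObstructionTheoryFor i (fibrations C))

/-- `i` has a fibrant obstruction theory: the same, but only for the fibrations with
fibrant target. -/
def HasFibrantObstructionTheory {A B : C} (i : A ⟶ B) : Prop :=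
  Nonempty (ObstructionTheoryFor i (fibrationsWithFibrantTarget C))

/-- `a : A ⟶ CA` exhibits `CA` as a cone on `A` and `q : CA ⟶ SA` is a cofibre of `a`, so that
`SA` is a suspension of `A`. -/
def IsSuspension {A CA SA : C} (a : A ⟶ CA) (q : CA ⟶ SA) : Prop :=
  Cofibration a ∧ IsWeaklyContractible CA ∧
    ∃ w : a ≫ q = 0, Nonempty (IsColimit (CokernelCofork.ofπ q w))

/-- `s : SA ⟶ SB` is a construction of the suspension of `i : A ⟶ B`: it is the map induced on
cofibres by an extension `c : CA ⟶ CB` of `i` to some cones on `A` and `B`. -/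
def IsSuspensionMap {A B SA SB : C} (i : A ⟶ B) (s : SA ⟶ SB) : Prop :=
  ∃ (CA CB : C) (a : A ⟶ CA) (b : B ⟶ CB) (c : CA ⟶ CB) (qA : CA ⟶ SA) (qB : CB ⟶ SB),
    IsSuspension a qA ∧ IsSuspension b qB ∧ a ≫ c = i ≫ b ∧ qA ≫ s = c ≫ qB

/-- `j : S ⟶ T` is a model for the suspension of `i`: it is weakly equivalent to a construction of
the suspension. Every construction of the suspension has cofibrant source (see the
lemmas below); a replacement by a weakly equivalent map has to keep this property unless the model
category is left proper. -/
def IsSuspensionModel {A B S T : C} (i : A ⟶ B) (j : S ⟶ T) : Prop :=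
  (IsCofibrant S ∨ LeftProper C) ∧
    ∃ (SA SB : C) (s : SA ⟶ SB), IsSuspensionMap i s ∧
      WeaklyEquivalent (Arrow.mk s) (Arrow.mk j)

lemma IsSuspension.isCofibrant {A CA SA : C} {a : A ⟶ CA} {q : CA ⟶ SA}
    (h : IsSuspension a q) : IsCofibrant SA := by
  obtain ⟨ha, -, w, ⟨hq⟩⟩ := h
  have : HasZeroObject C := hasZeroObject_of_hasTerminal_object
  have hz : IsZero (⊥_ C) :=
    (isZero_zero C).of_iso (initialIsInitial.uniqueUpToIso (isZero_zero C).isInitial)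
  have key (s : PushoutCocone a (0 : A ⟶ ⊥_ C)) : a ≫ s.inl = 0 := by
    rw [s.condition, zero_comp]
  have fac (s : PushoutCocone a (0 : A ⟶ ⊥_ C)) :
      q ≫ hq.desc (CokernelCofork.ofπ s.inl (key s)) = s.inl :=
    Cofork.IsColimit.π_desc hq
  have sq : IsPushout a (0 : A ⟶ ⊥_ C) q (initial.to SA) := by
    refine ⟨⟨by rw [w, zero_comp]⟩, ⟨PushoutCocone.IsColimit.mk _
      (fun s => hq.desc (CokernelCofork.ofπ s.inl (key s))) fac
      (fun s => hz.eq_of_src _ _) (fun s m hm _ => ?_)⟩⟩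
    exact Cofork.IsColimit.hom_ext hq (hm.trans (fac s).symm)
  rw [isCofibrant_iff, cofibration_iff]
  exact MorphismProperty.of_isPushout sq.flip ((cofibration_iff _).1 ha)

/-- Every construction of the suspension of `i` is a model for it. -/
lemma IsSuspensionMap.isSuspensionModel {A B SA SB : C} {i : A ⟶ B} {s : SA ⟶ SB}
    (h : IsSuspensionMap i s) : IsSuspensionModel i s := by
  refine ⟨Or.inl ?_, SA, SB, s, h, Relation.EqvGen.refl _⟩
  obtain ⟨CA, CB, a, b, c, qA, qB, hA, -⟩ := h
  exact hA.isCofibrant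

end ObstructionTheory

/-! Choose cofibrant `A'` and `B'` over `A` and `B` and a cone `CA'`, put `W = CA' ∪_{A'} B'`, and
let `k : W ⟶ K` be a cofibration into a cone `K` on `B'`. Collapsing `B'` turns `W` into `ΣA'` and
`K` into `ΣB'`, so `Σi` is, up to weak equivalence, a cobase change of `k`
(`IsSuspensionMap.exists_cofibrant_model`). Lifting against `Σi` thus becomes lifting against a
cofibration with weakly contractible target. Pulling a fibration back to a fibrant replacement `K'`
of `K` gives a total space `E` weakly equivalent to the fibre `F`; the lift exists exactly when `W ⟶
E` is trivial in the homotopy category (`exists_lift_iff_toHo_map_eq_zero`). The obstruction is this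
class, carried back along `F ⟶ E`.

To reach an arbitrary model `j`, replace arrows functorially by fibrations `R p` between fibrant
objects. A zigzag from `Σi` to `j` becomes a single levelwise weak equivalence to `R j`
(`exists_arrowWeq_of_weaklyEquivalent`), and every square `j ⟶ p` induces `R j ⟶ R p`. Solvability
survives these changes if base change along fibrations preserves `(η p).right`, which follows from
fibrant target or right properness, and if cobase change along cofibrations preserves the maps of
sources, which follows from cofibrancy or left properness. Functoriality of the obstruction is that
of `R`. -/

namespace ObstructionTheory

/-! ### Base and cobase change of weak equivalences -/

section Proper

variable {C : Type u} [Category.{v} C] [ModelCategory C]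

/-- Every base change of `w` along a fibration is a weak equivalence. -/
def BaseChangeWeq {Y' Y : C} (w : Y' ⟶ Y) : Prop :=
  ∀ ⦃X' X : C⦄ ⦃w' : X' ⟶ X⦄ ⦃p' : X' ⟶ Y'⦄ ⦃p : X ⟶ Y⦄,
    IsPullback w' p' p w → Fibration p → WeakEquivalence w'

/-- Every cobase change of `w` along a cofibration is a weak equivalence. -/
def CobaseChangeWeq {A A' : C} (w : A ⟶ A') : Prop :=
  ∀ ⦃B B' : C⦄ ⦃i : A ⟶ B⦄ ⦃w' : B ⟶ B'⦄ ⦃i' : A' ⟶ B'⦄,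
    IsPushout i w w' i' → Cofibration i → WeakEquivalence w'

lemma fibration_of_isPullback {P X Y Z : C} {fst : P ⟶ X} {snd : P ⟶ Y} {f : X ⟶ Z} {g : Y ⟶ Z}
    (h : IsPullback fst snd f g) (hf : Fibration f) : Fibration snd := by
  rw [fibration_iff] at hf ⊢
  exact MorphismProperty.of_isPullback h hf

lemma weakEquivalence_of_isPullback {P X Y Z : C} {fst : P ⟶ X} {snd : P ⟶ Y} {f : X ⟶ Z}
    {g : Y ⟶ Z} (h : IsPullback fst snd f g) [Fibration f] [WeakEquivalence f] :
    WeakEquivalence snd := by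
  rw [weakEquivalence_iff]
  exact (MorphismProperty.of_isPullback h (mem_trivialFibrations f)).2

lemma cofibration_of_isPushout {Z X Y P : C} {f : Z ⟶ X} {g : Z ⟶ Y} {inl : X ⟶ P} {inr : Y ⟶ P}
    (h : IsPushout f g inl inr) (hf : Cofibration f) : Cofibration inr := by
  rw [cofibration_iff] at hf ⊢
  exact MorphismProperty.of_isPushout h.flip hf

/-- Ken Brown's factorization of a weak equivalence between fibrations over a common base. -/
lemma exists_brown_over {X Z Y : C} (p : X ⟶ Y) (q : Z ⟶ Y) (w : X ⟶ Z) (hw : w ≫ q = p)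
    [Fibration p] [Fibration q] [WeakEquivalence w] :
    ∃ (E : C) (i : X ⟶ E) (π : E ⟶ Z) (r : E ⟶ X), i ≫ π = w ∧ i ≫ r = 𝟙 X ∧
      r ≫ p = π ≫ q ∧ Fibration π ∧ WeakEquivalence π ∧ Fibration r ∧ WeakEquivalence r := by
  have : IsFibrant (Over.mk p) := by
    rw [isFibrant_iff_of_isTerminal (Over.mkIdTerminal.from (Over.mk p)) Over.mkIdTerminal,
      fibrations_over_iff]
    simpa
  have : IsFibrant (Over.mk q) := by
    rw [isFibrant_iff_of_isTerminal (Over.mkIdTerminal.from (Over.mk q)) Over.mkIdTerminal,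
      fibrations_over_iff]
    simpa
  let w' : Over.mk p ⟶ Over.mk q := Over.homMk w hw
  have : WeakEquivalence w' := by rw [weakEquivalences_over_iff]; assumption
  let h : FibrantBrownFactorization w' := Classical.arbitrary _
  refine ⟨h.Z.left, h.i.left, h.p.left, h.r.left, ?_, ?_, ?_, inferInstance, inferInstance,
    inferInstance, inferInstance⟩
  · exact congr_arg Over.Hom.left h.fac
  · exact congr_arg Over.Hom.left h.i_r
  · exact (Over.w h.r).trans (Over.w h.p).symm

/-- Brown's factorization writes `w` as a section of a trivial fibration followed by a trivial
fibration. All of this lives over `Y`, so it survives base change along an arbitrary `g`. -/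
lemma weakEquivalence_of_isPullback_over {X Z Y X' Z' Y' : C} {p : X ⟶ Y} {q : Z ⟶ Y} {w : X ⟶ Z}
    {g : Y' ⟶ Y} {x : X' ⟶ X} {p' : X' ⟶ Y'} {z : Z' ⟶ Z} {q' : Z' ⟶ Y'} {w' : X' ⟶ Z'}
    (hX : IsPullback x p' p g) (hZ : IsPullback z q' q g) (hw : w ≫ q = p)
    (hwz : w' ≫ z = x ≫ w) (hwq : w' ≫ q' = p') (hp : Fibration p) (hq : Fibration q)
    (hwe : WeakEquivalence w) : WeakEquivalence w' := by
  obtain ⟨E, i, π, r, iπ, ir, rp, _, _, _, _⟩ := exists_brown_over p q w hw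
  have hE := IsPullback.of_hasPullback r x
  let a : pullback r x ⟶ Z' := hZ.lift (pullback.fst r x ≫ π) (pullback.snd r x ≫ p') (by
    rw [Category.assoc, ← rp, Category.assoc, ← hX.w, pullback.condition_assoc])
  have haq : a ≫ q' = pullback.snd r x ≫ p' := hZ.lift_snd _ _ _
  have haz : a ≫ z = pullback.fst r x ≫ π := hZ.lift_fst _ _ _
  have ha : IsPullback (pullback.fst r x) a π z :=
    IsPullback.of_bot (by rw [haq, ← rp]; exact hE.paste_vert hX) haz.symm hZ
  have := weakEquivalence_of_isPullback ha
  let s : X' ⟶ pullback r x := hE.lift (x ≫ i) (𝟙 X') (by simp [ir])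
  have : WeakEquivalence s :=
    weakEquivalence_of_postcomp_of_fac (g := pullback.snd r x) (fg := 𝟙 X') (by simp [s])
  have hs : s ≫ a = w' := by
    apply hZ.hom_ext
    · rw [Category.assoc, haz, hE.lift_fst_assoc, Category.assoc, iπ, hwz]
    · rw [Category.assoc, haq, hE.lift_snd_assoc, Category.id_comp, hwq]
  rw [← hs]
  infer_instance

/-- The base change of `p` along `i` is the pullback along `i` of the graph `X ⟶ X ×_{Y'} E`, a weak
equivalence between fibrations over `E`; the pullback of its target is `X` itself. -/
lemma baseChangeWeq_of_section {Y' E : C} (i : Y' ⟶ E) (r : E ⟶ Y') (ir : i ≫ r = 𝟙 Y')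
    (hr : Fibration r) (hr' : WeakEquivalence r) : BaseChangeWeq i := by
  intro X' X x' p' p sq hp
  have hB := IsPullback.of_hasPullback (p ≫ r) r
  have : Fibration (p ≫ r) := inferInstance
  let w : X ⟶ pullback (p ≫ r) r := hB.lift (𝟙 X) p (by simp)
  have : WeakEquivalence w :=
    weakEquivalence_of_postcomp_of_fac (g := pullback.fst (p ≫ r) r) (fg := 𝟙 X) (by simp [w])
  let b : X ⟶ pullback (p ≫ r) r := hB.lift (𝟙 X) (p ≫ r ≫ i) (by simp [ir])
  have hb : IsPullback b (p ≫ r) (pullback.snd (p ≫ r) r) i := by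
    refine IsPullback.of_right ?_ (by simp [b]) hB
    simpa [b, ir] using IsPullback.id_horiz (p ≫ r)
  refine weakEquivalence_of_isPullback_over sq hb (w := w) (by simp [w]) ?_ ?_ hp
    inferInstance inferInstance
  · apply hB.hom_ext
    · simp [b, w]
    · simp [b, w, reassoc_of% sq.w, sq.w, reassoc_of% ir]
  · rw [← Category.assoc, sq.w, Category.assoc, ir, Category.comp_id]

lemma baseChangeWeq_of_trivialFibration {Y' Y : C} (w : Y' ⟶ Y) [Fibration w]
    [WeakEquivalence w] : BaseChangeWeq w :=
  fun _ _ _ _ _ sq _ ↦ weakEquivalence_of_isPullback sq.flip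

lemma BaseChangeWeq.comp {Y'' Y' Y : C} {w' : Y'' ⟶ Y'} {w : Y' ⟶ Y} (hw' : BaseChangeWeq w')
    (hw : BaseChangeWeq w) : BaseChangeWeq (w' ≫ w) := by
  intro X'' X x p'' p sq hp
  have h := IsPullback.of_hasPullback p w
  have h1 := hw h hp
  have h2 := hw' (IsPullback.of_right' sq h) inferInstance
  rw [← h.lift_fst x (p'' ≫ w') (by rw [sq.w, Category.assoc])]
  infer_instance

/-- A weak equivalence between fibrant objects is preserved by base change along fibrations. -/
lemma baseChangeWeq_of_isFibrant {Y' Y : C} (w : Y' ⟶ Y) [IsFibrant Y'] [IsFibrant Y]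
    [WeakEquivalence w] : BaseChangeWeq w := by
  let h : FibrantBrownFactorization w := Classical.arbitrary _
  rw [← h.fac]
  exact (baseChangeWeq_of_section h.i h.r h.i_r inferInstance inferInstance).comp
    (baseChangeWeq_of_trivialFibration h.p)

lemma weakEquivalence_of_isPushout_under {A X Z A' X' Z' : C} {p : A ⟶ X} {q : A ⟶ Z} {w : X ⟶ Z}
    {g : A ⟶ A'} {x : X ⟶ X'} {p' : A' ⟶ X'} {z : Z ⟶ Z'} {q' : A' ⟶ Z'} {w' : X' ⟶ Z'}
    (hX : IsPushout p g x p') (hZ : IsPushout q g z q') (hw : p ≫ w = q)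
    (hwz : x ≫ w' = w ≫ z) (hwq : p' ≫ w' = q') (hp : Cofibration p) (hq : Cofibration q)
    (hwe : WeakEquivalence w) : WeakEquivalence w' := by
  rw [← weakEquivalences_op_iff]
  exact weakEquivalence_of_isPullback_over (w := w.op) hZ.flip.op hX.flip.op
    (by rw [← op_comp, hw]) (by rw [← op_comp, hwz, op_comp]) (by rw [← op_comp, hwq])
    inferInstance inferInstance ((weakEquivalences_op_iff w).2 hwe)

/-- A weak equivalence between cofibrant objects is preserved by cobase change along
cofibrations. -/
lemma cobaseChangeWeq_of_isCofibrant {A A' : C} (w : A ⟶ A') [IsCofibrant A] [IsCofibrant A']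
    [WeakEquivalence w] : CobaseChangeWeq w := by
  intro B B' i w' i' sq hi
  have h (X : C) [IsCofibrant X] : IsFibrant (Opposite.op X) := by
    rw [isFibrant_iff_of_isTerminal (initial.to X).op (terminalOpOfInitial initialIsInitial)]
    infer_instance
  have := h A
  have := h A'
  have : WeakEquivalence w.op := (weakEquivalences_op_iff w).2 inferInstance
  rw [← weakEquivalences_op_iff]
  exact baseChangeWeq_of_isFibrant w.op sq.flip.op inferInstance

lemma LeftProper.cobaseChangeWeq (h : LeftProper C) {A A' : C} (w : A ⟶ A') [WeakEquivalence w] :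
    CobaseChangeWeq w :=
  fun _ _ _ _ _ sq hi ↦ h _ _ _ _ sq hi inferInstance

lemma RightProper.baseChangeWeq (h : RightProper C) {Y' Y : C} (w : Y' ⟶ Y) [WeakEquivalence w] :
    BaseChangeWeq w :=
  fun _ _ _ _ _ sq hp ↦ h _ _ _ _ sq hp inferInstance

/-- The gluing lemma for cobase changes of cofibrations along morphisms to a common object. -/
lemma weakEquivalence_of_gluing {A A' B B' D S S' : C} {a : A ⟶ B} {a' : A' ⟶ B'} {u : A ⟶ A'}
    {v : B ⟶ B'} {d : A' ⟶ D} {q : B ⟶ S} {e : D ⟶ S} {q' : B' ⟶ S'} {e' : D ⟶ S'} {s : S ⟶ S'}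
    (h : IsPushout a (u ≫ d) q e) (h' : IsPushout a' d q' e') (hu : CobaseChangeWeq u)
    (hv : WeakEquivalence v) (ha : Cofibration a) (ha' : Cofibration a') (huv : a ≫ v = u ≫ a')
    (hq : q ≫ s = v ≫ q') (he : e ≫ s = e') : WeakEquivalence s := by
  -- Cobase change along `u` reduces to a weak equivalence between cofibrations under `A'`, which
  -- any further cobase change along `d` preserves.
  have hP := IsPushout.of_hasPushout a u
  have := hu hP ha
  have hPS := IsPushout.of_top' h hP
  let w : pushout a u ⟶ B' := hP.desc v a' huv
  have : WeakEquivalence w :=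
    weakEquivalence_of_precomp_of_fac (f := pushout.inl a u) (fg := v) (by simp [w])
  refine weakEquivalence_of_isPushout_under hPS h' (w := w) (by simp [w]) ?_ he
    inferInstance ha' inferInstance
  apply hP.hom_ext
  · simp [w, hq]
  · simp [w, he, h'.w]

end Proper

/-! ### Invariance of lifting problems -/

section Lifting

variable {C : Type u} [Category.{v} C]

/-- A morphism of arrows, viewed as a commutative square, admits a diagonal lift. -/
def Lifts {k p : Arrow C} (f : k ⟶ p) : Prop :=
  ∃ l : k.right ⟶ p.left, k.hom ≫ l = f.left ∧ l ≫ p.hom = f.right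

lemma Lifts.precomp {k k' p : Arrow C} {f : k' ⟶ p} (h : Lifts f) (φ : k ⟶ k') :
    Lifts (φ ≫ f) := by
  obtain ⟨l, h₁, h₂⟩ := h
  exact ⟨φ.right ≫ l, by rw [← Arrow.w_assoc, h₁, Arrow.comp_left],
    by rw [Category.assoc, h₂, Arrow.comp_right]⟩

lemma Lifts.postcomp {k p p' : Arrow C} {f : k ⟶ p} (h : Lifts f) (φ : p ⟶ p') :
    Lifts (f ≫ φ) := by
  obtain ⟨l, h₁, h₂⟩ := h
  exact ⟨l ≫ φ.left, by rw [reassoc_of% h₁, Arrow.comp_left],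
    by rw [Category.assoc, Arrow.w, reassoc_of% h₂, Arrow.comp_right]⟩

lemma lifts_comp_iff_of_isPushout {k k' p : Arrow C} (φ : k ⟶ k') (f : k' ⟶ p)
    (h : IsPushout k.hom φ.left φ.right k'.hom) : Lifts (φ ≫ f) ↔ Lifts f := by
  refine ⟨fun ⟨l, h₁, h₂⟩ ↦ ?_, fun h ↦ h.precomp φ⟩
  rw [Arrow.comp_left] at h₁
  rw [Arrow.comp_right] at h₂
  refine ⟨h.desc l f.left h₁, h.inr_desc _ _ _, ?_⟩
  apply h.hom_ext
  · simpa using h₂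
  · simp

variable [ModelCategory C]

/-- The lift defined on `k.right` glues to the pushout, extends over the trivial cofibration `h.i`,
and is restricted to `k'.right` by lifting `k'` against the trivial fibration `h.p`. -/
lemma lifts_comp_iff_of_weakEquivalence {k k' p : Arrow C} (φ : k ⟶ k') (f : k' ⟶ p)
    (hk : Cofibration k.hom) (hk' : Cofibration k'.hom) (hl : CobaseChangeWeq φ.left)
    (hr : WeakEquivalence φ.right) (hp : Fibration p.hom) : Lifts (φ ≫ f) ↔ Lifts f := by
  refine ⟨fun ⟨l, h₁, h₂⟩ ↦ ?_, fun h ↦ h.precomp φ⟩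
  rw [Arrow.comp_left] at h₁
  rw [Arrow.comp_right] at h₂
  have hP := IsPushout.of_hasPushout k.hom φ.left
  have := hl hP hk
  let m : pushout k.hom φ.left ⟶ k'.right := hP.desc φ.right k'.hom φ.w.symm
  have : WeakEquivalence m :=
    weakEquivalence_of_precomp_of_fac (f := pushout.inl _ _) (fg := φ.right) (by simp [m])
  let h := MorphismProperty.factorizationData (cofibrations C) (trivialFibrations C) m
  have : WeakEquivalence h.i := weakEquivalence_of_postcomp_of_fac h.fac
  let x : pushout k.hom φ.left ⟶ p.left := hP.desc l f.left h₁
  have sq : CommSq x h.i p.hom (h.p ≫ f.right) := ⟨by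
    apply hP.hom_ext
    · simpa [x, m] using h₂
    · simp [x, m]⟩
  have sq' : CommSq (pushout.inr k.hom φ.left ≫ h.i) k'.hom h.p (𝟙 _) := ⟨by simp [m]⟩
  refine ⟨sq'.lift ≫ sq.lift, ?_, ?_⟩
  · rw [sq'.fac_left_assoc, Category.assoc, sq.fac_left]
    simp [x]
  · rw [Category.assoc, sq.fac_right, sq'.fac_right_assoc, Category.id_comp]

/-- Lifts over a fibration may be tested after a levelwise weak equivalence to another fibration,
provided base change along the latter preserves the weak equivalence of targets. -/
lemma lifts_comp_iff_of_baseChangeWeq {j p p' : Arrow C} (f : j ⟶ p) (η : p ⟶ p')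
    (hj : Cofibration j.hom) (hp : Fibration p.hom) (hp' : Fibration p'.hom)
    (hl : WeakEquivalence η.left) (hr : BaseChangeWeq η.right) : Lifts (f ≫ η) ↔ Lifts f := by
  refine ⟨fun ⟨l, h₁, h₂⟩ ↦ ?_, fun h ↦ h.postcomp η⟩
  rw [Arrow.comp_left] at h₁
  rw [Arrow.comp_right] at h₂
  have hZ := IsPullback.of_hasPullback p'.hom η.right
  have := hr hZ hp'
  let z : p.left ⟶ pullback p'.hom η.right := hZ.lift η.left p.hom η.w
  have : WeakEquivalence z :=
    weakEquivalence_of_postcomp_of_fac (g := pullback.fst _ _) (fg := η.left) (by simp [z])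
  let h := MorphismProperty.factorizationData (cofibrations C) (trivialFibrations C) z
  have : WeakEquivalence h.i := weakEquivalence_of_postcomp_of_fac h.fac
  let y : j.right ⟶ pullback p'.hom η.right := hZ.lift l f.right h₂
  have sq : CommSq (f.left ≫ h.i) j.hom h.p y := ⟨by
    apply hZ.hom_ext
    · simpa [z, y] using h₁.symm
    · simp [z, y]⟩
  have sq' : CommSq (𝟙 p.left) h.i p.hom (h.p ≫ pullback.snd _ _) := ⟨by simp [z]⟩
  refine ⟨sq.lift ≫ sq'.lift, ?_, ?_⟩
  · rw [sq.fac_left_assoc, Category.assoc, sq'.fac_left, Category.comp_id]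
  · rw [Category.assoc, sq'.fac_right, sq.fac_right_assoc]
    simp [y]

/-- Two levelwise weakly equivalent cofibrations over a common arrow `r` detect the same lifting
problems among those which factor through `r`. -/
lemma lifts_comp_iff_lifts_comp {j k r p : Arrow C} (φ : j ⟶ r) (ψ : k ⟶ r) (g : r ⟶ p)
    (hj : Cofibration j.hom) (hk : Cofibration k.hom) (hp : Fibration p.hom)
    (hφl : CobaseChangeWeq φ.left) (hφr : WeakEquivalence φ.right)
    (hψl : CobaseChangeWeq ψ.left) (hψr : WeakEquivalence ψ.right) :
    Lifts (φ ≫ g) ↔ Lifts (ψ ≫ g) := by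
  -- The cofibration part of `r` is a common comparison object: `φ` and `ψ` both factor through it.
  let h := MorphismProperty.factorizationData (cofibrations C) (trivialFibrations C) r.hom
  let π : Arrow.mk h.i ⟶ r := Arrow.homMk (𝟙 _) h.p (by simp)
  have key {k : Arrow C} (ψ : k ⟶ r) (hk : Cofibration k.hom) (hψl : CobaseChangeWeq ψ.left)
      (hψr : WeakEquivalence ψ.right) :
      Lifts (ψ ≫ g) ↔ Lifts (π ≫ g) := by
    have sq : CommSq (ψ.left ≫ h.i) k.hom h.p ψ.right := ⟨by simp⟩
    let ψ' : k ⟶ Arrow.mk h.i := Arrow.homMk ψ.left sq.lift (by simp)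
    have hψ' : ψ' ≫ π = ψ := by
      ext <;> simp [ψ', π]
    have : WeakEquivalence sq.lift := weakEquivalence_of_postcomp_of_fac sq.fac_right
    rw [← lifts_comp_iff_of_weakEquivalence ψ' _ hk (inferInstanceAs (Cofibration h.i)) hψl this
      hp, ← Category.assoc, hψ']
  rw [key φ hj hφl hφr, key ψ hk hψl hψr]

end Lifting

/-! ### Fibrant replacement of arrows and straightening of zigzags -/

section Zigzag

variable {C : Type u} [Category.{v} C] [ModelCategory C]

/-- A functorial replacement of arrows by fibrations between fibrant objects. -/
lemma exists_functorial_fibrant_replacement (hC : HasFunctorialFactorizations C) :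
    ∃ (R : Arrow C ⥤ Arrow C) (η : ∀ p, p ⟶ R.obj p),
      (∀ ⦃p q : Arrow C⦄ (f : p ⟶ q), f ≫ η q = η p ≫ R.map f) ∧
      ∀ p, Cofibration (η p).left ∧ WeakEquivalence (η p).left ∧ WeakEquivalence (η p).right ∧
        Fibration (R.obj p).hom ∧ IsFibrant (R.obj p).right := by
  obtain ⟨-, ⟨⟨D⟩⟩⟩ := hC
  let T : C ⥤ Arrow C :=
    { obj Y := Arrow.mk (terminal.from Y)
      map g := Arrow.homMk g (𝟙 _) (terminal.hom_ext _ _) }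
  let ι (Y : C) : Y ⟶ D.Z.obj (T.obj Y) := D.i.app (T.obj Y)
  have hι {Y Y' : C} (g : Y ⟶ Y') : g ≫ ι Y' = ι Y ≫ D.Z.map (T.map g) := D.i.naturality (T.map g)
  -- The target is made fibrant first; factoring the composite `X ⟶ Y ⟶ Y^f` then yields a fibration
  -- over it.
  let H : Arrow C ⥤ Arrow C :=
    { obj p := Arrow.mk (p.hom ≫ ι p.right)
      map {p p'} φ := Arrow.homMk φ.left (D.Z.map (T.map φ.right)) (by simp [← hι])
      map_id p := by
        ext
        · rfl
        · exact (congr_arg D.Z.map (T.map_id p.right)).trans (D.Z.map_id _)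
      map_comp φ ψ := by
        ext
        · rfl
        · exact (congr_arg D.Z.map (T.map_comp φ.right ψ.right)).trans (D.Z.map_comp _ _) }
  let R : Arrow C ⥤ Arrow C :=
    { obj p := Arrow.mk (D.p.app (H.obj p))
      map φ := Arrow.homMk (D.Z.map (H.map φ)) (D.Z.map (T.map φ.right)) (D.p.naturality (H.map φ))
      map_id p := by
        ext
        · exact (congr_arg D.Z.map (H.map_id p)).trans (D.Z.map_id _)
        · exact (congr_arg D.Z.map (T.map_id p.right)).trans (D.Z.map_id _)
      map_comp φ ψ := by
        ext
        · exact (congr_arg D.Z.map (H.map_comp φ ψ)).trans (D.Z.map_comp _ _)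
        · exact (congr_arg D.Z.map (T.map_comp φ.right ψ.right)).trans (D.Z.map_comp _ _) }
  let η (p : Arrow C) : p ⟶ R.obj p := Arrow.homMk (D.i.app (H.obj p)) (ι p.right) D.fac_app
  refine ⟨R, η, fun p q f ↦ ?_, fun p ↦ ⟨?_, ?_, ?_, ?_, ?_⟩⟩
  · ext
    · exact D.i.naturality (H.map f)
    · exact hι f.right
  · exact (cofibration_iff _).2 (D.hi (H.obj p)).1
  · exact (weakEquivalence_iff _).2 (D.hi (H.obj p)).2
  · exact (weakEquivalence_iff _).2 (D.hi (T.obj p.right)).2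
  · exact (fibration_iff _).2 (D.hp (H.obj p))
  · exact (isFibrant_iff_of_isTerminal (D.p.app (T.obj p.right)) terminalIsTerminal).2
      ((fibration_iff _).2 (D.hp (T.obj p.right)))

/-- Levelwise weak equivalences of arrows. -/
def ArrowWeq {f g : Arrow C} (φ : f ⟶ g) : Prop :=
  WeakEquivalence φ.left ∧ WeakEquivalence φ.right

lemma ArrowWeq.comp {f g h : Arrow C} {φ : f ⟶ g} {ψ : g ⟶ h} (hφ : ArrowWeq φ)
    (hψ : ArrowWeq ψ) : ArrowWeq (φ ≫ ψ) := by
  have := hφ.1; have := hφ.2; have := hψ.1; have := hψ.2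
  exact ⟨inferInstanceAs (WeakEquivalence (φ.left ≫ ψ.left)),
    inferInstanceAs (WeakEquivalence (φ.right ≫ ψ.right))⟩

/-- A levelwise weak equivalence from a cofibration between cofibrant objects lifts along a
levelwise weak equivalence from a fibration between fibrant objects. -/
lemma exists_arrowWeq_of_arrowWeq {s r r' : Arrow C} (ψ : s ⟶ r) (θ : r' ⟶ r)
    (hψ : ArrowWeq ψ) (hθ : ArrowWeq θ) (hs : Cofibration s.hom) (hs' : IsCofibrant s.left)
    (hr : Fibration r'.hom) (hr' : IsFibrant r'.right) : ∃ ψ' : s ⟶ r', ArrowWeq ψ' := by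
  have := hψ.1; have := hψ.2; have := hθ.1; have := hθ.2
  -- `d` and `e` factor `θ` in the projective model structure on arrows: `d.p` and `e.p` are trivial
  -- fibrations, so the projectively cofibrant `s` lifts through them; `d.i` and `e.i` are trivial
  -- cofibrations, so the projectively fibrant `r'` is a retract of the middle arrow.
  let d := MorphismProperty.factorizationData (trivialCofibrations C) (fibrations C) θ.left
  have : WeakEquivalence d.p := weakEquivalence_of_precomp_of_fac d.fac
  have hP := IsPushout.of_hasPushout d.i r'.hom
  let m : pushout d.i r'.hom ⟶ r.right := hP.desc (d.p ≫ r.hom) θ.right (by simp)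
  let e := MorphismProperty.factorizationData (trivialCofibrations C) (fibrations C) m
  have : WeakEquivalence (pushout.inr d.i r'.hom) := inferInstance
  have : WeakEquivalence m :=
    weakEquivalence_of_precomp_of_fac (f := pushout.inr d.i r'.hom) (fg := θ.right) (by simp [m])
  have : WeakEquivalence e.p := weakEquivalence_of_precomp_of_fac e.fac
  have hfib : IsFibrant r'.left := isFibrant_of_fibration r'.hom
  -- the lift of `ψ` to the factorization
  have sq₁ : CommSq (initial.to d.Z) (initial.to s.left) d.p ψ.left :=
    ⟨Subsingleton.elim _ _⟩
  have sq₂ : CommSq (sq₁.lift ≫ pushout.inl d.i r'.hom ≫ e.i) s.hom e.p ψ.right := ⟨by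
    simp [m, sq₁.fac_right_assoc]⟩
  -- the retraction of the factorization onto `r'`
  have sq₃ : CommSq (𝟙 r'.left) d.i (terminal.from _) (terminal.from _) :=
    ⟨Subsingleton.elim _ _⟩
  let ρ : pushout d.i r'.hom ⟶ r'.right :=
    hP.desc (sq₃.lift ≫ r'.hom) (𝟙 _) (by simp)
  have sq₄ : CommSq ρ e.i (terminal.from _) (terminal.from _) := ⟨Subsingleton.elim _ _⟩
  have : WeakEquivalence sq₁.lift := weakEquivalence_of_postcomp_of_fac sq₁.fac_right
  have : WeakEquivalence sq₂.lift := weakEquivalence_of_postcomp_of_fac sq₂.fac_right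
  have : WeakEquivalence sq₃.lift := weakEquivalence_of_precomp_of_fac sq₃.fac_left
  have : WeakEquivalence ρ :=
    weakEquivalence_of_precomp_of_fac (f := pushout.inr d.i r'.hom) (fg := 𝟙 _) (by simp [ρ])
  have : WeakEquivalence sq₄.lift := weakEquivalence_of_precomp_of_fac sq₄.fac_left
  refine ⟨Arrow.homMk (sq₁.lift ≫ sq₃.lift) (sq₂.lift ≫ sq₄.lift) ?_, ?_, ?_⟩
  · rw [sq₂.fac_left_assoc]
    simp [ρ]
  · exact inferInstanceAs (WeakEquivalence (sq₁.lift ≫ sq₃.lift))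
  · exact inferInstanceAs (WeakEquivalence (sq₂.lift ≫ sq₄.lift))

/-- Having a levelwise weak equivalence from `s` to `R a` is invariant along the zigzag: forward
steps compose, and backward steps use `exists_arrowWeq_of_arrowWeq`. -/
lemma exists_arrowWeq_of_weaklyEquivalent {R : Arrow C ⥤ Arrow C} {η : ∀ p, p ⟶ R.obj p}
    (hnat : ∀ ⦃p q : Arrow C⦄ (f : p ⟶ q), f ≫ η q = η p ≫ R.map f)
    (hη : ∀ p, ArrowWeq (η p)) (hR : ∀ p, Fibration (R.obj p).hom)
    (hR' : ∀ p, IsFibrant (R.obj p).right) {s t j : Arrow C} (hs : Cofibration s.hom)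
    (hs' : IsCofibrant s.left) (φ : s ⟶ t) (hφ : ArrowWeq φ) (htj : WeaklyEquivalent t j) :
    ∃ ψ : s ⟶ R.obj j, ArrowWeq ψ := by
  have hmap {a b : Arrow C} (χ : a ⟶ b) (hχ : ArrowWeq χ) : ArrowWeq (R.map χ) := by
    have h := hχ.comp (hη b)
    rw [hnat χ] at h
    have := (hη a).1; have := (hη a).2
    have h₁ := h.1
    have h₂ := h.2
    rw [Arrow.comp_left] at h₁
    rw [Arrow.comp_right] at h₂
    exact ⟨weakEquivalence_of_precomp (η a).left _,
      weakEquivalence_of_precomp (η a).right _⟩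
  have key : (∃ ψ : s ⟶ R.obj t, ArrowWeq ψ) ↔ ∃ ψ : s ⟶ R.obj j, ArrowWeq ψ := by
    clear hφ φ
    induction htj with
    | rel a b h =>
      obtain ⟨χ, hχ⟩ := h
      refine ⟨fun ⟨ψ, hψ⟩ ↦ ⟨ψ ≫ R.map χ, hψ.comp (hmap χ hχ)⟩, fun ⟨ψ, hψ⟩ ↦ ?_⟩
      exact exists_arrowWeq_of_arrowWeq ψ (R.map χ) hψ (hmap χ hχ) hs hs' (hR a) (hR' a)
    | refl a => rfl
    | symm a b _ h => exact h.symm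
    | trans a b c _ _ h h' => exact h.trans h'
  exact key.1 ⟨φ ≫ η t, hφ.comp (hη t)⟩

end Zigzag

/-! ### Fibres as pullbacks -/

section Kernel

open ZeroObject

lemma isPullback_kernel {C : Type u} [Category.{v} C] [HasZeroObject C] [HasZeroMorphisms C]
    [HasKernels C] {X Y : C} (p : X ⟶ Y) :
    IsPullback (kernel.ι p) (0 : kernel p ⟶ 0) p 0 := by
  refine IsPullback.mk' (by simp) (fun T a b h _ ↦ ?_) fun T a b h ↦ ?_
  · rwa [cancel_mono] at h
  · exact ⟨kernel.lift p a (by simp [h]), by simp, (isZero_zero C).eq_of_tgt _ _⟩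

end Kernel

/-! ### Weakly contractible objects, suspensions and fibres -/

section Pointed

open ZeroObject

variable {C : Type u} [Category.{v} C] [ModelCategory C]

lemma IsWeaklyContractible.of_weakEquivalence {X Y : C} (h : IsWeaklyContractible Y) (f : X ⟶ Y)
    [WeakEquivalence f] : IsWeaklyContractible X := by
  have : WeakEquivalence (terminal.from Y) := h
  rw [IsWeaklyContractible, ← terminal.comp_from f]
  infer_instance

lemma IsWeaklyContractible.of_weakEquivalence' {X Y : C} (h : IsWeaklyContractible X) (f : X ⟶ Y)
    [WeakEquivalence f] : IsWeaklyContractible Y := by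
  have : WeakEquivalence (terminal.from X) := h
  exact weakEquivalence_of_precomp_of_fac (terminal.comp_from f)

variable [HasZeroMorphisms C]

/-- In the homotopy category, every morphism out of a weakly contractible object is trivial. -/
lemma IsWeaklyContractible.toHo_map_eq_zero {X Y : C} (h : IsWeaklyContractible X) (f : X ⟶ Y) :
    (toHo C).map f = (toHo C).map 0 := by
  have : IsIso ((toHo C).map (terminal.from X)) :=
    Localization.inverts (toHo C) (weakEquivalences C) _ ((weakEquivalence_iff _).1 h)
  have h' : (toHo C).map (𝟙 X) = (toHo C).map (0 : X ⟶ X) := by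
    rw [← cancel_mono ((toHo C).map (terminal.from X)), ← Functor.map_comp, ← Functor.map_comp]
    congr 1
    exact terminal.hom_ext _ _
  calc (toHo C).map f = (toHo C).map (𝟙 X) ≫ (toHo C).map f := by simp
    _ = (toHo C).map 0 := by rw [h', ← Functor.map_comp, zero_comp]

/-- For a fibration over a fibrant weakly contractible object, lifting problems against a
cofibration from a cofibrant object to a weakly contractible object are solvable precisely when the
map of sources is trivial in the homotopy category. -/
lemma exists_lift_iff_toHo_map_eq_zero {W K E K' : C} (k : W ⟶ K) (q : E ⟶ K') (x : W ⟶ E)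
    (y : K ⟶ K') (w : x ≫ q = k ≫ y) [Cofibration k] [Fibration q] [IsCofibrant W]
    [IsFibrant K'] (hK : IsWeaklyContractible K) (hK' : IsWeaklyContractible K') :
    (∃ l : K ⟶ E, k ≫ l = x ∧ l ≫ q = y) ↔ (toHo C).map x = (toHo C).map 0 := by
  constructor
  · rintro ⟨l, rfl, -⟩
    rw [Functor.map_comp, hK.toHo_map_eq_zero l, ← Functor.map_comp, comp_zero]
  · intro h
    have : IsFibrant E := isFibrant_of_fibration q
    -- Since `0` extends over `K`, homotopy extension gives some `l` with `k ≫ l = x`, possibly with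
    -- `l ≫ q ≠ y`.
    have h' : RightHomotopyRel 0 x := (RightHomotopyRel.iff_map_eq (toHo C) W E).2 h.symm
    obtain ⟨Q, _, ⟨H⟩⟩ := h'.exists_good_pathObject
    obtain ⟨l, H', hl⟩ := PathObject.RightHomotopy.homotopy_extension H k 0 comp_zero
    have hkl : k ≫ l = x := by rw [← H'.h₁, ← Category.assoc, hl, H.h₁]
    -- To correct `l`: `d.Z` is a cylinder on `K` relative to `W`. As `K'` is trivially fibrant, `l
    -- ≫ q` and `y` are homotopic relative to `W`; lifting this homotopy from `l` through `q` and
    -- taking its other end gives the lift.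
    have hD := IsPushout.of_hasPushout k k
    let c : pushout k k ⟶ K := hD.desc (𝟙 K) (𝟙 K) rfl
    let d := MorphismProperty.factorizationData (cofibrations C) (trivialFibrations C) c
    let g : pushout k k ⟶ K' := hD.desc (l ≫ q) y (by rw [reassoc_of% hkl, w])
    have : WeakEquivalence (terminal.from K') := hK'
    have sq : CommSq g d.i (terminal.from K') (terminal.from _) := ⟨terminal.hom_ext _ _⟩
    have : WeakEquivalence (pushout.inl k k ≫ d.i) :=
      weakEquivalence_of_postcomp_of_fac (g := d.p) (fg := 𝟙 K) (by simp [c])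
    have sq' : CommSq l (pushout.inl k k ≫ d.i) q sq.lift := ⟨by simp [g]⟩
    refine ⟨pushout.inr k k ≫ d.i ≫ sq'.lift, ?_, ?_⟩
    · have := sq'.fac_left
      rw [← hD.w_assoc, ← hkl]
      rw [← Category.assoc, ← Category.assoc, Category.assoc k, Category.assoc, this]
    · simp [sq'.fac_right, g]

variable [HasZeroObject C]

lemma IsWeaklyContractible.weakEquivalence_zero {X : C} (h : IsWeaklyContractible X) :
    WeakEquivalence (0 : (0 : C) ⟶ X) := by
  have : WeakEquivalence (terminal.from X) := h
  have : IsIso (terminal.from (0 : C)) :=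
    ⟨0, (isZero_zero C).eq_of_src _ _, terminal.hom_ext _ _⟩
  exact weakEquivalence_of_postcomp_of_fac (terminal.comp_from (0 : (0 : C) ⟶ X))

lemma isPushout_of_isSuspension {A CA SA : C} {a : A ⟶ CA} {q : CA ⟶ SA}
    (h : IsSuspension a q) : IsPushout a (0 : A ⟶ 0) q 0 := by
  obtain ⟨-, -, w, ⟨hq⟩⟩ := h
  have key (s : PushoutCocone a (0 : A ⟶ 0)) : a ≫ s.inl = 0 := by rw [s.condition, zero_comp]
  have fac (s : PushoutCocone a (0 : A ⟶ 0)) :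
      q ≫ hq.desc (CokernelCofork.ofπ s.inl (key s)) = s.inl := Cofork.IsColimit.π_desc hq
  exact ⟨⟨by rw [w, zero_comp]⟩, ⟨PushoutCocone.IsColimit.mk _
    (fun s ↦ hq.desc (CokernelCofork.ofπ s.inl (key s))) fac
    (fun s ↦ (isZero_zero C).eq_of_src _ _)
    (fun s m hm _ ↦ Cofork.IsColimit.hom_ext hq (hm.trans (fac s).symm))⟩⟩

/-- A construction of the suspension is weakly equivalent to a cofibration with cofibrant source
which is a cobase change of a cofibration from a cofibrant object to a weakly contractible one. -/
lemma IsSuspensionMap.exists_cofibrant_model {A B SA SB : C} {i : A ⟶ B} {s : SA ⟶ SB}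
    (hs : IsSuspensionMap i s) (hi : Cofibration i) (hA : IsCofibrant A ∨ LeftProper C) :
    ∃ (k s' : Arrow C) (χ : k ⟶ s') (φ : s' ⟶ Arrow.mk s), Cofibration k.hom ∧
      IsCofibrant k.left ∧ IsWeaklyContractible k.right ∧
      IsPushout k.hom χ.left χ.right s'.hom ∧ IsCofibrant s'.left ∧ ArrowWeq φ := by
  obtain ⟨CA, CB, a, b, c, qA, qB, hqA, hqB, hac, hqs⟩ := hs
  have hcob {X X' : C} (u : X ⟶ X') [IsCofibrant X] [WeakEquivalence u]
      (h : IsCofibrant X' ∨ LeftProper C) : CobaseChangeWeq u := by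
    obtain h | h := h
    · exact cobaseChangeWeq_of_isCofibrant u
    · exact h.cobaseChangeWeq u
  have hB : IsCofibrant B ∨ LeftProper C :=
    hA.imp_left fun h ↦ isCofibrant_of_cofibration (hX := h) i
  -- The given cones need not be cofibrant when `A` is not, so everything is rebuilt over cofibrant
  -- replacements.
  let dA := MorphismProperty.factorizationData (cofibrations C) (trivialFibrations C) (initial.to A)
  have : IsCofibrant dA.Z := by
    rw [isCofibrant_iff, Subsingleton.elim (initial.to dA.Z) dA.i]
    infer_instance
  let dB := MorphismProperty.factorizationData (cofibrations C) (trivialFibrations C) (dA.p ≫ i)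
  have : IsCofibrant dB.Z := isCofibrant_of_cofibration dB.i
  let dCA := MorphismProperty.factorizationData (cofibrations C) (trivialFibrations C) (dA.p ≫ a)
  have : IsCofibrant dCA.Z := isCofibrant_of_cofibration dCA.i
  have hW := IsPushout.of_hasPushout dCA.i dB.i
  let m : pushout dCA.i dB.i ⟶ CB := hW.desc (dCA.p ≫ c) (dB.p ≫ b) (by simp [hac])
  let dCB := MorphismProperty.factorizationData (cofibrations C) (trivialFibrations C) m
  have hWc : IsCofibrant (pushout dCA.i dB.i) := isCofibrant_of_cofibration (pushout.inl dCA.i dB.i)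
  have hS := IsPushout.of_hasPushout dCA.i (0 : dA.Z ⟶ 0)
  let b' := pushout.inr dCA.i dB.i ≫ dCB.i
  have hb' : Cofibration b' := inferInstance
  have hT := IsPushout.of_hasPushout b' (0 : dB.Z ⟶ 0)
  let x : pushout dCA.i dB.i ⟶ pushout dCA.i (0 : dA.Z ⟶ 0) :=
    hW.desc (pushout.inl _ _) (0 ≫ pushout.inr _ _) (by rw [hS.w]; simp)
  let t : pushout dCA.i (0 : dA.Z ⟶ 0) ⟶ pushout b' (0 : dB.Z ⟶ 0) :=
    hS.desc (pushout.inl dCA.i dB.i ≫ dCB.i ≫ pushout.inl _ _) (pushout.inr _ _) (by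
      rw [hW.w_assoc, ← Category.assoc (pushout.inr _ _), hT.w]
      simp)
  -- Collapsing `B'` in `CA' ∪_{A'} B'` has the same effect as collapsing `A'` in `CA'`.
  have hx : IsPushout (pushout.inr dCA.i dB.i) (0 : dB.Z ⟶ 0) x (pushout.inr _ _) :=
    IsPushout.of_top (by simpa [x] using hS) (by simp [x]) hW
  have hk : IsPushout dCB.i x (pushout.inl b' (0 : dB.Z ⟶ 0)) t := by
    refine IsPushout.of_left (by simpa [t] using hT) ?_ hx
    apply hW.hom_ext
    · simp [x, t]
    · simpa [x, t, b'] using hT.w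
  have hqA' := isPushout_of_isSuspension hqA
  have hqB' := isPushout_of_isSuspension hqB
  let φl : pushout dCA.i (0 : dA.Z ⟶ 0) ⟶ SA := hS.desc (dCA.p ≫ qA) 0 (by simp [hqA'.w])
  let φr : pushout b' (0 : dB.Z ⟶ 0) ⟶ SB := hT.desc (dCB.p ≫ qB) 0 (by simp [b', m, hqB'.w])
  refine ⟨Arrow.mk dCB.i, Arrow.mk t, Arrow.homMk x (pushout.inl _ _) hk.w.symm,
    Arrow.homMk φl φr ?_, inferInstanceAs (Cofibration dCB.i), hWc,
    hqB.2.1.of_weakEquivalence dCB.p, hk, ?_, ?_, ?_⟩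
  · apply hS.hom_ext
    · simp [φl, φr, t, m, hqs]
    · exact (isZero_zero C).eq_of_src _ _
  · have : IsCofibrant (0 : C) := by
      rw [isCofibrant_iff_of_isInitial (𝟙 (0 : C)) (isZero_zero C).isInitial]
      infer_instance
    exact isCofibrant_of_cofibration (pushout.inr dCA.i (0 : dA.Z ⟶ 0))
  · exact weakEquivalence_of_gluing (d := 0) (by simpa using hS) hqA' (hcob dA.p hA)
      (v := dCA.p) inferInstance inferInstance hqA.1 (by simp) (by simp [φl]) (by simp [φl])
  · exact weakEquivalence_of_gluing (d := 0) (by simpa using hT) hqB' (hcob dB.p hB)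
      (v := dCB.p) inferInstance inferInstance hqB.1 (by simp [b', m]) (by simp [φr]) (by simp [φr])

/-- The induced map from the fibre of a fibration `p` to the pullback of a fibrant replacement
of `p` along a map from a fibrant weakly contractible object is a weak equivalence. -/
lemma weakEquivalence_of_kernel_to_pullback {p p' : Arrow C} (η : p ⟶ p') {K' E : C}
    {g : K' ⟶ p'.right} {fst : E ⟶ p'.left} {snd : E ⟶ K'} (hE : IsPullback fst snd p'.hom g)
    (c : kernel p.hom ⟶ E) (hc : c ≫ fst = kernel.ι p.hom ≫ η.left) (hc' : c ≫ snd = 0)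
    [Fibration p.hom] [Fibration p'.hom] [IsFibrant K']
    (hK' : IsWeaklyContractible K') (hl : WeakEquivalence η.left) (hr : BaseChangeWeq η.right) :
    WeakEquivalence c := by
  have hZ := IsPullback.of_hasPullback p'.hom η.right
  have := hr hZ inferInstance
  let z : p.left ⟶ pullback p'.hom η.right := hZ.lift η.left p.hom η.w
  have : WeakEquivalence z :=
    weakEquivalence_of_postcomp_of_fac (g := pullback.fst _ _) (fg := η.left) (by simp [z])
  -- `c` factors through the fibre of `E` over `0`: the first factor is a base change of `z` over
  -- `p.right`, the second a base change of `0 ⟶ K'`, a weak equivalence between fibrant objects.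
  have hF := IsPullback.of_hasPullback snd (0 : (0 : C) ⟶ K')
  have : Fibration snd := fibration_of_isPullback hE inferInstance
  have : IsFibrant (0 : C) := by
    rw [isFibrant_iff_of_isTerminal (𝟙 (0 : C)) (isZero_zero C).isTerminal]
    infer_instance
  have := hK'.weakEquivalence_zero
  have := baseChangeWeq_of_isFibrant (0 : (0 : C) ⟶ K') hF inferInstance
  have hFp : IsPullback (pullback.fst snd (0 : (0 : C) ⟶ K') ≫ fst) (pullback.snd _ _) p'.hom
      (0 ≫ η.right) := by
    rw [show (0 : (0 : C) ⟶ p.right) ≫ η.right = 0 ≫ g from (isZero_zero C).eq_of_src _ _]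
    exact hF.paste_horiz hE
  have hFz := IsPullback.of_right' hFp hZ
  let e : kernel p.hom ⟶ pullback snd (0 : (0 : C) ⟶ K') := hF.lift c 0 (by simp [hc'])
  have : WeakEquivalence e := by
    refine weakEquivalence_of_isPullback_over (isPullback_kernel p.hom) hFz (w := z) (by simp [z])
      ?_ (by simp [e]) inferInstance inferInstance inferInstance
    apply hZ.hom_ext
    · simp [e, z, hc]
    · simp [e, z]
  rw [← show e ≫ pullback.fst _ _ = c by simp [e]]
  infer_instance

end Pointed

/-! ### The obstruction class -/

section Construction

variable {C : Type u} [Category.{v} C] [ModelCategory C] [HasZeroObject C] [HasZeroMorphisms C]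

/-- The obstruction theory of `j` obtained from a functorial fibrant replacement `η : p ⟶ R p` of
arrows and a weak equivalence `ψ : s ⟶ R j`, where `s` is a cobase change of a cofibration `k` from
a cofibrant to a weakly contractible object. -/
lemma nonempty_obstructionTheoryFor {S T : C} {j : S ⟶ T} (hj : Cofibration j)
    {P : MorphismProperty C} (hP : P ≤ fibrations C) {R : Arrow C ⥤ Arrow C}
    {η : ∀ p, p ⟶ R.obj p} (hnat : ∀ ⦃p q : Arrow C⦄ (f : p ⟶ q), f ≫ η q = η p ≫ R.map f)
    (hη : ∀ p, ArrowWeq (η p)) (hR : ∀ p, Fibration (R.obj p).hom)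
    (hR' : ∀ p, IsFibrant (R.obj p).right)
    (hPη : ∀ p : Arrow C, P p.hom → BaseChangeWeq (η p).right) {k s : Arrow C} (χ : k ⟶ s)
    (ψ : s ⟶ R.obj (Arrow.mk j)) (hk : Cofibration k.hom) (hkl : IsCofibrant k.left)
    (hkr : IsWeaklyContractible k.right) (hχ : IsPushout k.hom χ.left χ.right s.hom)
    (hψ : ArrowWeq ψ) (hψl : CobaseChangeWeq ψ.left)
    (hjl : CobaseChangeWeq (η (Arrow.mk j)).left) :
    Nonempty (ObstructionTheoryFor j P) := by
  have hRj := hR' (Arrow.mk j)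
  let d := MorphismProperty.factorizationData (trivialCofibrations C) (fibrations C)
    (terminal.from k.right)
  have hK' : IsWeaklyContractible d.Z := hkr.of_weakEquivalence' d.i
  have hK'f : IsFibrant d.Z :=
    (isFibrant_iff_of_isTerminal d.p terminalIsTerminal).2 inferInstance
  -- One extension of `K ⟶ R T` to `K'` is fixed for all squares; postcomposing it with `R f` makes
  -- `t` strictly natural.
  have sqt : CommSq (χ.right ≫ ψ.right) d.i (terminal.from _) (terminal.from _) :=
    ⟨terminal.hom_ext _ _⟩
  obtain ⟨t, ht, ht'⟩ : ∃ t : ∀ {p : Arrow C}, (Arrow.mk j ⟶ p) → (d.Z ⟶ (R.obj p).right),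
      (∀ {p : Arrow C} (f : Arrow.mk j ⟶ p), d.i ≫ t f = χ.right ≫ ψ.right ≫ (R.map f).right) ∧
      ∀ {p p' : Arrow C} (f : Arrow.mk j ⟶ p) (φ : p ⟶ p'),
        t (f ≫ φ) = t f ≫ (R.map φ).right :=
    ⟨fun f ↦ sqt.lift ≫ (R.map f).right, fun f ↦ by simp [sqt.fac_left_assoc],
      fun f φ ↦ by simp⟩
  have hE {p : Arrow C} (f : Arrow.mk j ⟶ p) := IsPullback.of_hasPullback (R.obj p).hom (t f)
  let x {p : Arrow C} (f : Arrow.mk j ⟶ p) : k.left ⟶ pullback (R.obj p).hom (t f) :=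
    (hE f).lift ((χ ≫ ψ ≫ R.map f).left) (k.hom ≫ d.i) (by simp [ht])
  let c {p : Arrow C} (f : Arrow.mk j ⟶ p) : kernel p.hom ⟶ pullback (R.obj p).hom (t f) :=
    (hE f).lift (kernel.ι p.hom ≫ (η p).left) 0 (by
      rw [Category.assoc, Arrow.w, kernel.condition_assoc, zero_comp, zero_comp])
  have hc {p : Arrow C} (hp : P p.hom) (f : Arrow.mk j ⟶ p) : IsIso ((toHo C).map (c f)) := by
    have : Fibration p.hom := (fibration_iff _).2 (hP _ hp)
    have := weakEquivalence_of_kernel_to_pullback (η p) (hE f) (c f) (by simp [c])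
      (by simp [c]) hK' (hη p).1 (hPη p hp)
    exact Localization.inverts (toHo C) (weakEquivalences C) _ ((weakEquivalence_iff _).1 this)
  refine ⟨
    { W := k.left
      obstruction p hp f := (toHo C).map (x f) ≫ @inv _ _ _ _ ((toHo C).map (c f)) (hc hp f)
      lift_iff p hp f := ?_
      functorial p p' hp hp' f φ := ?_ }⟩
  · have hp' : Fibration p.hom := (fibration_iff _).2 (hP _ hp)
    have := hc hp f
    change Lifts f ↔ _
    -- Triviality of the class becomes a lifting problem over `K'`. On the other side, `f` is traded
    -- for `f ≫ η p = η j ≫ R.map f`, then for `ψ ≫ R.map f`, then for `χ ≫ ψ ≫ R.map f`; the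
    -- universal property of the pullback identifies the two problems.
    rw [IsIso.comp_inv_eq, ← Functor.map_comp, zero_comp,
      ← exists_lift_iff_toHo_map_eq_zero k.hom (pullback.snd _ _) (x f) d.i (by simp [x]) hkr hK',
      ← lifts_comp_iff_of_baseChangeWeq f (η p) hj hp' (hR p) (hη p).1 (hPη p hp),
      hnat f,
      lifts_comp_iff_lifts_comp (η (Arrow.mk j)) ψ (R.map f) hj
        (cofibration_of_isPushout hχ hk) (hR p) hjl (hη _).2 hψl hψ.2,
      ← lifts_comp_iff_of_isPushout χ _ hχ]
    constructor
    · rintro ⟨l, h₁, h₂⟩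
      refine ⟨(hE f).lift l d.i ?_, ?_, (hE f).lift_snd _ _ _⟩
      · rw [h₂]
        simp [ht]
      · apply (hE f).hom_ext
        · simpa [x] using h₁
        · simp [x]
    · rintro ⟨l, h₁, h₂⟩
      refine ⟨l ≫ pullback.fst _ _, ?_, ?_⟩
      · rw [reassoc_of% h₁]
        simp [x]
      · rw [Category.assoc, pullback.condition, reassoc_of% h₂]
        simp [ht]
  · have := hc hp f
    have := hc hp' (f ≫ φ)
    let e : pullback (R.obj p).hom (t f) ⟶ pullback (R.obj p').hom (t (f ≫ φ)) :=
      (hE (f ≫ φ)).lift (pullback.fst _ _ ≫ (R.map φ).left) (pullback.snd _ _) (by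
        rw [Category.assoc, Arrow.w, pullback.condition_assoc, ht'])
    have hx : x f ≫ e = x (f ≫ φ) := by
      apply (hE (f ≫ φ)).hom_ext <;> simp [x, e]
    have hce : c f ≫ e = kernel.map p.hom p'.hom φ.left φ.right φ.w.symm ≫ c (f ≫ φ) := by
      have h : φ.left ≫ (η p').left = (η p).left ≫ (R.map φ).left :=
        congr_arg Arrow.Hom.left (hnat φ)
      apply (hE (f ≫ φ)).hom_ext <;> simp [c, e, h]
    have hx' : (toHo C).map (x f) ≫ (toHo C).map e = (toHo C).map (x (f ≫ φ)) := by
      rw [← Functor.map_comp, hx]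
    have hce' : (toHo C).map (c f) ≫ (toHo C).map e =
        (toHo C).map (kernel.map p.hom p'.hom φ.left φ.right φ.w.symm) ≫
          (toHo C).map (c (f ≫ φ)) := by
      rw [← Functor.map_comp, hce, Functor.map_comp]
    rw [← hx', IsIso.comp_inv_eq, Category.assoc, Category.assoc, ← hce',
      IsIso.inv_hom_id_assoc]

end Construction

end ObstructionTheory

open ObstructionTheory in
theorem theorem8p2 {C : Type u} [Category.{v} C] [ModelCategory C]
    [HasZeroObject C] [HasZeroMorphisms C]
    (hC : ObstructionTheory.HasFunctorialFactorizations C)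
    {A B : C} (i : A ⟶ B) (hi : Cofibration i)
    (hA : IsCofibrant A ∨ ObstructionTheory.LeftProper C)
    {S T : C} (j : S ⟶ T) (hj : Cofibration j)
    (hij : ObstructionTheory.IsSuspensionModel i j) :
    ObstructionTheory.HasFibrantObstructionTheory j ∧
      (ObstructionTheory.RightProper C → ObstructionTheory.HasObstructionTheory j) := by
  obtain ⟨hS, SA, SB, s, hs, hsj⟩ := hij
  obtain ⟨k, s', χ, φ, hk, hkl, hkr, hχ, hs', hφ⟩ := hs.exists_cofibrant_model hi hA
  obtain ⟨R, η, hnat, hRη⟩ := exists_functorial_fibrant_replacement hC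
  have hη p : ArrowWeq (η p) := ⟨(hRη p).2.1, (hRη p).2.2.1⟩
  have hR p : Fibration (R.obj p).hom := (hRη p).2.2.2.1
  have hR' p : IsFibrant (R.obj p).right := (hRη p).2.2.2.2
  obtain ⟨ψ, hψ⟩ := exists_arrowWeq_of_weaklyEquivalent hnat hη hR hR'
    (cofibration_of_isPushout hχ hk) hs' φ hφ hsj
  have hψ₁ := hψ.1
  have hη₁ := (hη (Arrow.mk j)).1
  have hcob : CobaseChangeWeq ψ.left ∧ CobaseChangeWeq (η (Arrow.mk j)).left := by
    obtain hS | hS := hS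
    · have hS₁ : IsCofibrant (Arrow.mk j).left := hS
      -- The source of `R j` is cofibrant because `(η j).left` is a cofibration out of the cofibrant
      -- `S`.
      have := (hRη (Arrow.mk j)).1
      have := isCofibrant_of_cofibration (η (Arrow.mk j)).left
      exact ⟨cobaseChangeWeq_of_isCofibrant _, cobaseChangeWeq_of_isCofibrant _⟩
    · exact ⟨hS.cobaseChangeWeq _, hS.cobaseChangeWeq _⟩
  constructor
  · refine nonempty_obstructionTheoryFor hj (fun _ _ p hp ↦ hp.1.mem) hnat hη hR hR' (fun p hp ↦ ?_)
      χ ψ hk hkl hkr hχ hψ hcob.1 hcob.2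
    have : IsFibrant p.right := hp.2
    have := hR' p
    have := (hη p).2
    exact baseChangeWeq_of_isFibrant _
  · intro hRP
    refine nonempty_obstructionTheoryFor hj le_rfl hnat hη hR hR' (fun p _ ↦ ?_)
      χ ψ hk hkl hkr hχ hψ hcob.1 hcob.2
    have := (hη p).2
    exact hRP.baseChangeWeq _
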